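/- Let $a>0$, let $m\ge 1$ be an integer, let $p\in(1,\infty)$ and $\frac1p+\frac1{p^*}=1$. Let $\mathcal E=\mathbb R^{(-a,a)}$ be the space of all real functions on $(-a,a)$ with the topology of pointwise convergence and $\mathcal E'$ its topological dual (the finite linear combinations of Dirac functionals $\delta_t$, $t\in(-a,a)$). Let $\lambda_0,\dots,\lambda_{m-1}\in\mathcal E'$ have linearly independent restrictions to the space $\mathcal P_{m-1}$ of polynomials of degree at most $m-1$ on $(-a,a)$. Put: * $\mathcal A_p$: the functions $x$ of class $C^{m-1}$ on $(-a,a)$ with $x^{(m-1)}$ locally absolutely continuous and $x^{(j)}\in L^p(-a,a)$ for $0\le j\le m$, with $\|x\|_{\mathcal A_p}=\big(\sum_{k=0}^{m-1}|\lambda_k(x)|^p+\int_{-a}^a|x^{(m)}(t)|^p\,dt\big)^{1/p}$; * $\mathcal R_p=\mathcal P_{m-1}$, with $\|x\|_{\mathcal R_p}=\big(\sum_{k=0}^{m-1}|\lambda_k(x)|^p\big)^{1/p}$; * $\mathcal C_p$: the functions $x$ of class $C^{m-1}$ on $(-a,a)$ with $x^{(m-1)}$ locally absolutely continuous, $x^{(m)}\in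 L^p(-a,a)$ and $\lambda_k(x)=0$ for all $k$, with $\|x\|_{\mathcal C_p}=\big(\int_{-a}^a|x^{(m)}(t)|^p\,dt\big)^{1/p}$. For each $\mathcal B$ of these three spaces let $f_{\mathcal B}:\mathcal E\to(-\infty,+\infty]$ be $f_{\mathcal B}(e)=\frac1p\|e\|_{\mathcal B}^p$ if $e\in\mathcal B$ and $+\infty$ otherwise. The banachic kernel of $\mathcal B$ is the (a priori multi-valued) map $e'\mapsto\partial f_{\mathcal B}^*(e')\subset\mathcal E$ on $\mathcal E'$, where $f_{\mathcal B}^*(e')=\sup_{e\in\mathcal E}(\langle e,e'\rangle-f_{\mathcal B}(e))$ and $\partial f_{\mathcal B}^*(e')=\{e\in\mathcal E:\ f_{\mathcal B}^*(g')\ge f_{\mathcal B}^*(e')+\langle e,g'-e'\rangle\ \ \forall g'\in\mathcal E'\}$. Let $\alpha_{p^*}(\rho)=|\rho|^{p^*-1}\operatorname{sign}(\rho)$. Then there are unique $P_0,\dots,P_{m-1}\in\mathcal P_{m-1}$ with $\lambda_k(P_l)=\delta_{kl}$. Let $$\Lambda_m(s,\theta)=\frac1{(m-1)!}\Big[(s-\theta)_+^{m-1}-\sum_{k=0}^{m-1}\lambda_k\big((\cdot-\theta)_+^{m-1}\big)P_k(s)\Big]$$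 be the Peano kernel, where $u_+^{n}=u^n$ for $u>0$ and $u_+^n=0$ for $u\le 0$. It satisfies, for every $x\in\mathcal A_p$ and $s\in(-a,a)$, $$x(s)=\sum_{k=0}^{m-1}\lambda_k(x)P_k(s)+\int_{-a}^a\Lambda_m(s,\theta)\,x^{(m)}(\theta)\,d\theta .$$ The banachic kernels of $\mathcal A_p,\mathcal R_p,\mathcal C_p$ are single-valued, that is, given by maps $A_p,R_p,C_p:\mathcal E'\to\mathcal E$, and: (i) for all $e',f'\in\mathcal E'$, $$\langle R_pe',f'\rangle=\sum_{k=0}^{m-1}\alpha_{p^*}\big(\langle P_k,e'\rangle\big)\langle P_k,f'\rangle,\qquad \langle C_pe',f'\rangle=\int_{-a}^a\langle\Lambda_m(\cdot,\theta),f'\rangle\,\alpha_{p^*}\big(\langle\Lambda_m(\cdot,\theta),e'\rangle\big)\,d\theta ;$$ (ii) $A_p=R_p+C_p$. Consequently, for all $s,t\in(-a,a)$, $$\langle A_p\delta_s,\delta_t\rangle=\sum_{k=0}^{m-1}P_k(t)\,\alpha_{p^*}(P_k(s))+\int_{-a}^a\Lambda_m(t,\theta)\,\alpha_{p^*}(\Lambda_m(s,\theta))\,d\theta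 .$$ All integrals above are absolutely convergent. -/

import Mathlib

open MeasureTheory
open scoped BigOperators Pointwise

noncomputable section

namespace BanachicKernel

/-! ### Legendre-Fenchel transform, subdifferential and banachic kernel of a potential -/

/-- The Legendre-Fenchel transform of a functional on `E`, as a functional on the topological
dual of `E`. -/
def legendreFenchel {E : Type*} [AddCommGroup E] [Module ℝ E] [TopologicalSpace E]
    (Φ : E → EReal) (e' : StrongDual ℝ E) : EReal :=
  ⨆ e : E, (((e' e : ℝ) : EReal) - Φ e)

/-- The subdifferential, in the duality between `E'` and `E`, of a functional on `E'`:
the set of all `e` in `E` with `F f' ≥ F e' + ⟨e, f' - e'⟩` for every `f'`. -/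
def subdifferential {E : Type*} [AddCommGroup E] [Module ℝ E] [TopologicalSpace E]
    (F : StrongDual ℝ E → EReal) (e' : StrongDual ℝ E) : Set E :=
  {e | ∀ f' : StrongDual ℝ E, F e' + ((f' e - e' e : ℝ) : EReal) ≤ F f'}

/-- The banachic kernel of a potential `Φ`: the (multi-valued) map `∂Φ*` from `E'` to `E`. -/
def banachicKernel {E : Type*} [AddCommGroup E] [Module ℝ E] [TopologicalSpace E]
    (Φ : E → EReal) (e' : StrongDual ℝ E) : Set E :=
  subdifferential (legendreFenchel Φ) e'

open Classical in
/-- The potential `ω(‖x‖)`, `ω(ρ) = ρ ^ p / p`, attached to a subspace `B` of `E` with norm `N`;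
its value is `+∞` outside `B`. -/
def powerPotential {E : Type*} (B : Set E) (N : E → ℝ) (p : ℝ) (e : E) : EReal :=
  if e ∈ B then (((N e) ^ p / p : ℝ) : EReal) else ⊤

/-! ### The function spaces -/

/-- All real functions on `(-a, a)`, with the topology of pointwise convergence. -/
abbrev FunSpace (a : ℝ) : Type := Set.Ioo (-a) a → ℝ

open Classical in
/-- Extension by zero to the real line; only its restriction to `(-a, a)` matters. -/
def ext {a : ℝ} (x : FunSpace a) (t : ℝ) : ℝ :=
  if h : t ∈ Set.Ioo (-a) a then x ⟨t, h⟩ else 0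

/-- The derivative of order `j` of a function on `(-a, a)`. -/
def der {a : ℝ} (j : ℕ) (x : FunSpace a) : ℝ → ℝ := iteratedDeriv j (ext x)

/-- `x` has derivatives up to order `m` in the Sobolev sense: it is of class `C^(m-1)` on
`(-a, a)` and its derivative of order `m - 1` is locally absolutely continuous there
(so that the derivative of order `m` exists almost everywhere). -/
def HasDerivatives {a : ℝ} (m : ℕ) (x : FunSpace a) : Prop :=
  ContDiffOn ℝ ((m - 1 : ℕ) : ℕ∞) (ext x) (Set.Ioo (-a) a) ∧
    ∀ c ∈ Set.Ioo (-a) a, ∀ d ∈ Set.Ioo (-a) a,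
      AbsolutelyContinuousOnInterval (der (m - 1) x) c d

/-- The space `𝒜_p` of functions whose derivatives of order `0, …, m` are in `L^p(-a, a)`. -/
def spaceA (a : ℝ) (m : ℕ) (p : ℝ) : Set (FunSpace a) :=
  {x | HasDerivatives m x ∧
    ∀ j ≤ m, MemLp (der j x) (ENNReal.ofReal p) (volume.restrict (Set.Ioo (-a) a))}

/-- The space of polynomials of degree at most `m - 1`, mapped into the functions on `(-a, a)`. -/
def polyFun (a : ℝ) (m : ℕ) : Polynomial.degreeLT ℝ m →ₗ[ℝ] FunSpace a where
  toFun P := fun t => (P : Polynomial ℝ).eval (t : ℝ)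
  map_add' P Q := by ext t; simp
  map_smul' c P := by ext t; simp

/-- The space `ℛ_p` of polynomial functions of degree at most `m - 1` on `(-a, a)`. -/
def spaceR (a : ℝ) (m : ℕ) : Set (FunSpace a) := Set.range (polyFun a m)

/-- The space `𝒞_p` of functions with derivative of order `m` in `L^p(-a, a)` that are
annihilated by the functionals `lam k`. -/
def spaceC {a : ℝ} {m : ℕ} (lam : Fin m → StrongDual ℝ (FunSpace a)) (p : ℝ) :
    Set (FunSpace a) :=
  {x | HasDerivatives m x ∧
    MemLp (der m x) (ENNReal.ofReal p) (volume.restrict (Set.Ioo (-a) a)) ∧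
    ∀ k, lam k x = 0}

def normA {a : ℝ} {m : ℕ} (lam : Fin m → StrongDual ℝ (FunSpace a)) (p : ℝ)
    (x : FunSpace a) : ℝ :=
  (∑ k, |lam k x| ^ p + ∫ t in Set.Ioo (-a) a, |der m x t| ^ p) ^ (1 / p)

def normR {a : ℝ} {m : ℕ} (lam : Fin m → StrongDual ℝ (FunSpace a)) (p : ℝ)
    (x : FunSpace a) : ℝ :=
  (∑ k, |lam k x| ^ p) ^ (1 / p)

def normC {a : ℝ} (m : ℕ) (p : ℝ) (x : FunSpace a) : ℝ :=
  (∫ t in Set.Ioo (-a) a, |der m x t| ^ p) ^ (1 / p)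

/-! ### The banachic kernels of the three spaces -/

def kernelA {a : ℝ} {m : ℕ} (lam : Fin m → StrongDual ℝ (FunSpace a)) (p : ℝ) :
    StrongDual ℝ (FunSpace a) → Set (FunSpace a) :=
  banachicKernel (powerPotential (spaceA a m p) (normA lam p) p)

def kernelR {a : ℝ} {m : ℕ} (lam : Fin m → StrongDual ℝ (FunSpace a)) (p : ℝ) :
    StrongDual ℝ (FunSpace a) → Set (FunSpace a) :=
  banachicKernel (powerPotential (spaceR a m) (normR lam p) p)

def kernelC {a : ℝ} {m : ℕ} (lam : Fin m → StrongDual ℝ (FunSpace a)) (p : ℝ) :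
    StrongDual ℝ (FunSpace a) → Set (FunSpace a) :=
  banachicKernel (powerPotential (spaceC lam p) (normC m p) p)

/-! ### The explicit objects in the formulas -/

/-- `α_r(ρ) = |ρ|^(r-1) sign ρ`. -/
def alpha (r ρ : ℝ) : ℝ := |ρ| ^ (r - 1) * Real.sign ρ

/-- The Dirac functional at a point. -/
def dirac {a : ℝ} (s : Set.Ioo (-a) a) : StrongDual ℝ (FunSpace a) :=
  ContinuousLinearMap.proj s

/-- `P` is the basis of the polynomials of degree at most `m - 1` dual to `lam`. -/
def IsDualBasis {a : ℝ} {m : ℕ} (lam : Fin m → StrongDual ℝ (FunSpace a))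
    (P : Fin m → Polynomial.degreeLT ℝ m) : Prop :=
  ∀ k l, lam k (polyFun a m (P l)) = if k = l then 1 else 0

/-- The truncated power `u_+^n`, which for `n = 0` is the Heaviside function. -/
def truncPow (n : ℕ) (u : ℝ) : ℝ := if 0 < u then u ^ n else 0

/-- The Peano kernel
`Λ_m(s,θ) = ((s-θ)_+^(m-1) - ∑ k, ⟨(·-θ)_+^(m-1), lam k⟩ P_k(s)) / (m-1)!`. -/
def peanoKernel {a : ℝ} {m : ℕ} (lam : Fin m → StrongDual ℝ (FunSpace a))
    (P : Fin m → Polynomial.degreeLT ℝ m) (s : Set.Ioo (-a) a) (θ : ℝ) : ℝ :=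
  (truncPow (m - 1) ((s : ℝ) - θ) -
      ∑ k, lam k (fun u => truncPow (m - 1) ((u : ℝ) - θ)) * polyFun a m (P k) s) /
    ((m - 1).factorial : ℝ)

end BanachicKernel

end

/-!
The proof has two independent parts.

*Peano representation.* Write `y` for the primitive of order `m` of `g ∈ L¹(-a, a)` starting at `-a`.
By Cauchy's formula `y(s)` is the integral of `(s - θ)_+^(m-1) / (m-1)! * g(θ)` over `(-a, a)`, and the
functionals `lam k`, being finite combinations of Dirac functionals, commute with that integral.
Hence the Peano kernel represents the operator `g ↦ y - ∑ k, lam k y • P k`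
(`peanoOperator_eq`). A function `x` whose derivative of order `m` is integrable differs from the
primitive `y` of `x^(m)` by a polynomial of degree less than `m`
(`HasDerivatives.exists_eq_iterPrimitive_add`), and `Q = ∑ k, lam k Q • P k` for such polynomials, so
that `x = ∑ k, lam k x • P k + peanoOperator lam P x^(m)`. Conversely every
`∑ k, c k • P k + peanoOperator lam P g` has `lam k`-values `c k` and derivative `g` of order `m`
almost everywhere. Thus `𝒜_p` is parametrized by `ℝ^m × L^p(-a, a)`, with `ℛ_p` and `𝒞_p` as the two
factors.

*Duality.* In these coordinates, with `b k = e' (P k)` and `h(θ) = e' (Λ_m(·, θ))`, the functional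
`e' x - ‖x‖^p / p` is `∑ k, (b k * c k - |c k|^p / p) + ∫ (h g - |g|^p / p)`. By Young's inequality
and its case of equality (`mul_sub_abs_rpow_div_le`) it is maximal at `c k = α_q(b k)`, `g = α_q(h)`;
these maximizers are `polyKernel` and `integralKernel`. The maximizer lies in the subdifferential
of the conjugate function; that there is nothing else in it follows from the continuity of the
maximizer along lines `e' + t • d'`
(`banachicKernel_powerPotential_eq_singleton`), which is continuity of `α_q` together with
dominated convergence.
-/

namespace BanachicKernel

/-! ### Iterated primitives -/

/-- The primitive of order `n` of `g` all of whose lower order primitives vanish at `b`. -/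
noncomputable def iterPrimitive (b : ℝ) (g : ℝ → ℝ) : ℕ → ℝ → ℝ
  | 0 => g
  | n + 1 => fun s => ∫ t in b..s, iterPrimitive b g n t

/-- The innermost integration split off, whereas the definition splits off the outermost one. -/
theorem iterPrimitive_succ' (b : ℝ) (g : ℝ → ℝ) (n : ℕ) :
    iterPrimitive b g (n + 1) = iterPrimitive b (fun s => ∫ t in b..s, g t) n := by
  induction n with
  | zero => rfl
  | succ n ih =>
    funext s
    rw [iterPrimitive, ih]
    rfl

theorem absolutelyContinuousOnInterval_primitive {g : ℝ → ℝ} (hg : Integrable g) (b c d : ℝ) :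
    AbsolutelyContinuousOnInterval (fun s => ∫ t in b..s, g t) c d := by
  have h := (hg.intervalIntegrable (a := min b (min c d))
    (b := max b (max c d))).absolutelyContinuousOnInterval_intervalIntegral (c := b)
    (by rw [Set.mem_uIcc]; left; exact ⟨min_le_left _ _, le_max_left _ _⟩)
  refine h.mono ?_
  rw [Set.uIcc_of_le ((min_le_left b (min c d)).trans (le_max_left b (max c d)))]
  exact Set.Icc_subset_Icc (min_le_right _ _) (le_max_right _ _)

/-- As `g` is only integrable, the primitive of order `n + 1` is of class `C^n`; its derivative of
order `n` is the absolutely continuous function `∫ g`. -/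
theorem iteratedDeriv_iterPrimitive_succ {g : ℝ → ℝ} (hg : Integrable g) (b : ℝ) (n : ℕ) :
    ContDiff ℝ n (iterPrimitive b g (n + 1)) ∧
      iteratedDeriv n (iterPrimitive b g (n + 1)) = fun s => ∫ t in b..s, g t := by
  induction n with
  | zero =>
    refine ⟨?_, by simp [iterPrimitive]⟩
    rw [Nat.cast_zero, contDiff_zero]
    exact intervalIntegral.continuous_primitive (fun _ _ => hg.intervalIntegrable) b
  | succ n ih =>
    have hc : Continuous (iterPrimitive b g (n + 1)) := ih.1.continuous
    have hd (s : ℝ) : HasDerivAt (iterPrimitive b g (n + 2)) (iterPrimitive b g (n + 1) s) s :=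
      intervalIntegral.integral_hasDerivAt_right (hc.intervalIntegrable _ _)
        (hc.stronglyMeasurableAtFilter _ _) hc.continuousAt
    have hd' : deriv (iterPrimitive b g (n + 2)) = iterPrimitive b g (n + 1) :=
      funext fun s => (hd s).deriv
    refine ⟨?_, ?_⟩
    · rw [Nat.cast_add, Nat.cast_one, contDiff_succ_iff_deriv]
      exact ⟨fun s => (hd s).differentiableAt, by simp, by rw [hd']; exact ih.1⟩
    · rw [iteratedDeriv_succ', hd', ih.2]

/-- Cauchy's formula for repeated integration. -/
theorem iterPrimitive_succ_eq_integral (b : ℝ) (n : ℕ) (s : ℝ) {g : ℝ → ℝ}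
    (hg : ∀ c d, IntervalIntegrable g volume c d) :
    iterPrimitive b g (n + 1) s = ∫ t in b..s, (s - t) ^ n / n.factorial * g t := by
  induction n generalizing g with
  | zero => simp [iterPrimitive]
  | succ n ih =>
    have hc : Continuous fun s => ∫ t in b..s, g t := intervalIntegral.continuous_primitive hg b
    -- Integration by parts; the boundary terms vanish at `t = s` because of the factor `s - t`,
    -- and at `t = b` because the primitive of `g` does.
    have hu (t : ℝ) : HasDerivAt (fun t => -((s - t) ^ (n + 1) / (n + 1).factorial))
        ((s - t) ^ n / n.factorial) t := by
      convert! ((monomial_has_deriv_aux t s n).div_const ((n + 1).factorial : ℝ)).neg using 1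
      rw [Nat.factorial_succ]
      push_cast
      field_simp
    have hu' : deriv (fun t => -((s - t) ^ (n + 1) / (n + 1).factorial)) =
        fun t => (s - t) ^ n / (n.factorial : ℝ) := funext fun t => (hu t).deriv
    have huac : AbsolutelyContinuousOnInterval
        (fun t => -((s - t) ^ (n + 1) / ((n + 1).factorial : ℝ))) b s := by
      apply ContDiffOn.absolutelyContinuousOnInterval
      fun_prop
    have hvac := (hg b s).absolutelyContinuousOnInterval_intervalIntegral (c := b) (by simp)
    have hparts := huac.integral_mul_deriv_eq_deriv_mul hvac
    rw [iterPrimitive_succ', ih (fun c d => hc.intervalIntegrable c d)]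
    simp only [hu', sub_self, intervalIntegral.integral_same, mul_zero, ne_eq,
      Nat.add_eq_zero_iff, one_ne_zero, and_false, not_false_eq_true, zero_pow, zero_div,
      neg_zero, zero_mul, zero_sub] at hparts
    rw [← neg_eq_iff_eq_neg] at hparts
    rw [← hparts, ← intervalIntegral.integral_neg]
    apply intervalIntegral.integral_congr_ae
    filter_upwards [(hg b s).ae_hasDerivAt_integral] with t ht hts
    rw [(ht (Set.uIoc_subset_uIcc hts) b (by simp)).deriv]
    ring

/-! ### Functions with integrable derivative of order `m` -/

theorem exists_derivative_eq_of_mem_degreeLT {n : ℕ} {P : Polynomial ℝ}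
    (hP : P ∈ Polynomial.degreeLT ℝ n) :
    ∃ Q ∈ Polynomial.degreeLT ℝ (n + 1), Polynomial.derivative Q = P := by
  refine ⟨∑ i ∈ Finset.range n, Polynomial.monomial (i + 1) (P.coeff i / (i + 1)), ?_, ?_⟩
  · refine Submodule.sum_mem _ fun i hi => ?_
    rw [Polynomial.mem_degreeLT]
    refine (Polynomial.degree_monomial_le _ _).trans_lt ?_
    exact_mod_cast Nat.succ_lt_succ (Finset.mem_range.1 hi)
  · rw [Polynomial.derivative_sum]
    ext k
    simp only [Polynomial.derivative_monomial, Polynomial.finsetSum_coeff,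
      Polynomial.coeff_monomial, Nat.add_sub_cancel, Finset.sum_ite_eq', Finset.mem_range]
    split_ifs with hk
    · push_cast
      field_simp
    · rw [Polynomial.coeff_eq_zero_of_degree_lt]
      exact (Polynomial.mem_degreeLT.1 hP).trans_le (by exact_mod_cast not_lt.1 hk)

theorem iteratedDeriv_polynomial_eval (P : Polynomial ℝ) (n : ℕ) :
    iteratedDeriv n (fun t => P.eval t) = fun t => (Polynomial.derivative^[n] P).eval t := by
  induction n generalizing P with
  | zero => simp
  | succ n ih =>
    have h : deriv (fun t => P.eval t) = fun t => (Polynomial.derivative P).eval t :=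
      funext fun t => P.deriv
    rw [iteratedDeriv_succ', h, ih, Function.iterate_succ_apply]

theorem contDiff_polynomial_eval (P : Polynomial ℝ) (n : WithTop ℕ∞) :
    ContDiff ℝ n fun t => P.eval t := by
  simpa using P.contDiff_aeval (𝕜 := ℝ) (R := ℝ) n

/-- Integrating an identity `f^(n) = ∫ g + C` on an interval introduces a polynomial. -/
theorem exists_eqOn_iterPrimitive_add_eval {a : ℝ} {g : ℝ → ℝ} (hg : Integrable g) (n : ℕ)
    {f : ℝ → ℝ} (hf : ContDiffOn ℝ n f (Set.Ioo (-a) a)) {C : ℝ}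
    (h : ∀ s ∈ Set.Ioo (-a) a, iteratedDeriv n f s = (∫ t in (-a)..s, g t) + C) :
    ∃ P ∈ Polynomial.degreeLT ℝ (n + 1), ∀ s ∈ Set.Ioo (-a) a,
      f s = iterPrimitive (-a) g (n + 1) s + P.eval s := by
  induction n generalizing f with
  | zero =>
    refine ⟨Polynomial.C C, ?_, fun s hs => ?_⟩
    · rw [Polynomial.mem_degreeLT]
      exact Polynomial.degree_C_le.trans_lt (by norm_num)
    · simpa [iterPrimitive] using h s hs
  | succ n ih =>
    rw [Nat.cast_add, Nat.cast_one, contDiffOn_succ_iff_deriv_of_isOpen isOpen_Ioo] at hf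
    obtain ⟨P, hP, hPs⟩ := ih hf.2.2 fun s hs => by rw [← iteratedDeriv_succ', h s hs]
    obtain ⟨Q, hQ, hQP⟩ := exists_derivative_eq_of_mem_degreeLT hP
    have hc : Continuous (iterPrimitive (-a) g (n + 1)) :=
      (iteratedDeriv_iterPrimitive_succ hg (-a) n).1.continuous
    have hG (s : ℝ) : HasDerivAt (fun s => iterPrimitive (-a) g (n + 2) s + Q.eval s)
        (iterPrimitive (-a) g (n + 1) s + P.eval s) s := by
      refine HasDerivAt.add ?_ (hQP ▸ Q.hasDerivAt s)
      exact intervalIntegral.integral_hasDerivAt_right (hc.intervalIntegrable _ _)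
        (hc.stronglyMeasurableAtFilter _ _) hc.continuousAt
    obtain ⟨c, hc⟩ := isOpen_Ioo.exists_eq_add_of_deriv_eq isPreconnected_Ioo hf.1
      (fun s _ => (hG s).differentiableAt.differentiableWithinAt)
      (fun s hs => (hPs s hs).trans (hG s).deriv.symm)
    refine ⟨Q + Polynomial.C c, Submodule.add_mem _ hQ ?_, fun s hs => ?_⟩
    · rw [Polynomial.mem_degreeLT]
      exact Polynomial.degree_C_le.trans_lt (by exact_mod_cast Nat.succ_pos _)
    · rw [hc hs]
      simp [add_assoc]

theorem ext_apply {a : ℝ} (x : FunSpace a) (s : Set.Ioo (-a) a) : ext x s = x s := by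
  simp [ext, s.2]

/-- On the open interval the extension by zero does not influence the derivatives. -/
theorem der_eqOn {a : ℝ} {x : FunSpace a} {F : ℝ → ℝ}
    (h : ∀ s : Set.Ioo (-a) a, x s = F s) (j : ℕ) :
    Set.EqOn (der j x) (iteratedDeriv j F) (Set.Ioo (-a) a) := by
  intro t ht
  refine Filter.EventuallyEq.iteratedDeriv_eq j ?_
  filter_upwards [isOpen_Ioo.mem_nhds ht] with u hu
  exact (ext_apply x ⟨u, hu⟩).trans (h ⟨u, hu⟩)

/-- A function whose derivative of order `m` is integrable on `(-a, a)` differs from the primitive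
of order `m` of that derivative by a polynomial of degree less than `m`. -/
theorem HasDerivatives.exists_eq_iterPrimitive_add {a : ℝ} {n : ℕ} {x : FunSpace a}
    (ha : 0 < a) (hx : HasDerivatives (n + 1) x)
    (hi : IntegrableOn (der (n + 1) x) (Set.Ioo (-a) a)) :
    ∃ P ∈ Polynomial.degreeLT ℝ (n + 1), ∀ s : Set.Ioo (-a) a,
      x s = iterPrimitive (-a) ((Set.Ioo (-a) a).indicator (der (n + 1) x)) (n + 1) s +
        P.eval (s : ℝ) := by
  obtain ⟨hC, hac⟩ := hx
  rw [Nat.add_sub_cancel] at hC hac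
  set g := (Set.Ioo (-a) a).indicator (der (n + 1) x) with hg_def
  have hg : Integrable g := hi.integrable_indicator measurableSet_Ioo
  have h0 : (0 : ℝ) ∈ Set.Ioo (-a) a := ⟨neg_lt_zero.2 ha, ha⟩
  have hder : der (n + 1) x = deriv (der n x) := iteratedDeriv_succ
  obtain ⟨P, hP, h⟩ := exists_eqOn_iterPrimitive_add_eval hg n hC
    (C := der n x 0 - ∫ t in (-a)..0, g t) fun s hs => by
      have h1 := (hac 0 h0 s hs).integral_deriv_eq_sub
      have h2 : ∫ t in (0 : ℝ)..s, deriv (der n x) t = ∫ t in (0 : ℝ)..s, g t := by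
        refine intervalIntegral.integral_congr fun t ht => ?_
        have : t ∈ Set.Ioo (-a) a := (Set.ordConnected_Ioo.uIcc_subset h0 hs) ht
        simp [hg_def, this, hder]
      have h3 := intervalIntegral.integral_add_adjacent_intervals
        (hg.intervalIntegrable (a := -a) (b := 0)) (hg.intervalIntegrable (a := 0) (b := s))
      change der n x s = _
      linarith
  exact ⟨P, hP, fun s => (ext_apply x s).symm.trans (h s s.2)⟩

theorem contDiff_iterPrimitive_add_eval {g : ℝ → ℝ} (hg : Integrable g) (b : ℝ) (n : ℕ)
    (P : Polynomial ℝ) : ContDiff ℝ n fun s => iterPrimitive b g (n + 1) s + P.eval s :=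
  (iteratedDeriv_iterPrimitive_succ hg b n).1.add (contDiff_polynomial_eval P n)

theorem iteratedDeriv_iterPrimitive_add_eval {g : ℝ → ℝ} (hg : Integrable g) (b : ℝ) (n : ℕ)
    (P : Polynomial ℝ) :
    iteratedDeriv n (fun s => iterPrimitive b g (n + 1) s + P.eval s) =
      fun s => (∫ t in b..s, g t) + (Polynomial.derivative^[n] P).eval s := by
  obtain ⟨h1, h2⟩ := iteratedDeriv_iterPrimitive_succ hg b n
  funext s
  rw [iteratedDeriv_fun_add h1.contDiffAt (contDiff_polynomial_eval P n).contDiffAt, h2,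
    iteratedDeriv_polynomial_eval]

theorem hasDerivatives_of_eq_iterPrimitive_add {a : ℝ} {n : ℕ} {x : FunSpace a} {g : ℝ → ℝ}
    (hg : Integrable g) {P : Polynomial ℝ}
    (h : ∀ s : Set.Ioo (-a) a, x s = iterPrimitive (-a) g (n + 1) s + P.eval (s : ℝ)) :
    HasDerivatives (n + 1) x := by
  rw [HasDerivatives, Nat.add_sub_cancel]
  refine ⟨?_, fun c hc d hd => ?_⟩
  · refine (contDiff_iterPrimitive_add_eval hg (-a) n P).contDiffOn.congr fun s hs => ?_
    exact (ext_apply x ⟨s, hs⟩).trans (h ⟨s, hs⟩)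
  · have hac : AbsolutelyContinuousOnInterval
        (fun s => (∫ t in (-a)..s, g t) + (Polynomial.derivative^[n] P).eval s) c d :=
      (absolutelyContinuousOnInterval_primitive hg (-a) c d).fun_add
        (contDiff_polynomial_eval _ 1).contDiffOn.absolutelyContinuousOnInterval
    rw [← iteratedDeriv_iterPrimitive_add_eval hg] at hac
    have hder := der_eqOn (F := fun s => iterPrimitive (-a) g (n + 1) s + P.eval s) h n
    have hsub : Set.uIcc c d ⊆ Set.Ioo (-a) a := Set.ordConnected_Ioo.uIcc_subset hc hd
    rw [absolutelyContinuousOnInterval_iff] at hac ⊢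
    intro ε hε
    obtain ⟨δ, hδ, H⟩ := hac ε hε
    refine ⟨δ, hδ, fun E hE hlen => ?_⟩
    refine (Finset.sum_congr rfl fun i hi => ?_).trans_lt (H E hE hlen)
    rw [hder (hsub (hE.1 i hi).1), hder (hsub (hE.1 i hi).2)]

theorem der_ae_eq_of_eq_iterPrimitive_add {a : ℝ} {n : ℕ} {x : FunSpace a} {g : ℝ → ℝ}
    (hg : Integrable g) {P : Polynomial ℝ} (hP : P ∈ Polynomial.degreeLT ℝ (n + 1))
    (h : ∀ s : Set.Ioo (-a) a, x s = iterPrimitive (-a) g (n + 1) s + P.eval (s : ℝ)) :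
    der (n + 1) x =ᵐ[volume.restrict (Set.Ioo (-a) a)] g := by
  have hP0 : Polynomial.derivative (Polynomial.derivative^[n] P) = 0 := by
    rw [← Function.iterate_succ_apply' (f := Polynomial.derivative)]
    by_cases h0 : P = 0
    · simp [h0]
    · refine Polynomial.iterate_derivative_eq_zero ?_
      exact (Polynomial.natDegree_lt_iff_degree_lt h0).2 (Polynomial.mem_degreeLT.1 hP)
  filter_upwards [ae_restrict_mem measurableSet_Ioo,
    ae_restrict_of_ae (LocallyIntegrable.ae_hasDerivAt_integral hg.locallyIntegrable)] with t ht hgt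
  rw [der_eqOn (F := fun s => iterPrimitive (-a) g (n + 1) s + P.eval s) h (n + 1) ht, iteratedDeriv_succ, iteratedDeriv_iterPrimitive_add_eval hg]
  have hd := (hgt (-a)).add ((Polynomial.derivative^[n] P).hasDerivAt t)
  rw [hP0, Polynomial.eval_zero, add_zero] at hd
  exact hd.deriv

theorem memLp_der_of_eq_iterPrimitive_add {a : ℝ} {n : ℕ} {x : FunSpace a} {g : ℝ → ℝ}
    (hg : Integrable g) {P : Polynomial ℝ}
    (h : ∀ s : Set.Ioo (-a) a, x s = iterPrimitive (-a) g (n + 1) s + P.eval (s : ℝ))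
    {j : ℕ} (hj : j ≤ n) (r : ENNReal) :
    MemLp (der j x) r (volume.restrict (Set.Ioo (-a) a)) := by
  have hc : Continuous (iteratedDeriv j fun s => iterPrimitive (-a) g (n + 1) s + P.eval s) :=
    (contDiff_iterPrimitive_add_eval hg (-a) n P).continuous_iteratedDeriv j (by exact_mod_cast hj)
  obtain ⟨C, hC⟩ := (isCompact_Icc (a := -a) (b := a)).exists_bound_of_continuousOn hc.continuousOn
  refine MemLp.ae_eq (f := iteratedDeriv j fun s => iterPrimitive (-a) g (n + 1) s + P.eval s) ?_
    (MemLp.of_bound hc.aestronglyMeasurable C ?_)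
  · filter_upwards [ae_restrict_mem measurableSet_Ioo] with t ht using (der_eqOn h j ht).symm
  · filter_upwards [ae_restrict_mem measurableSet_Ioo] with t ht
    exact hC t (Set.Ioo_subset_Icc_self ht)

/-! ### Functionals for the topology of pointwise convergence -/

/-- A continuous functional for the topology of pointwise convergence is a finite linear
combination of Dirac functionals. -/
theorem exists_finset_forall_strongDual_eq_sum {ι : Type*} (e' : StrongDual ℝ (ι → ℝ)) :
    ∃ (I : Finset ι) (c : ι → ℝ), ∀ x, e' x = ∑ i ∈ I, c i * x i := by
  classical
  obtain ⟨U, hU, hUe⟩ : ∃ U ∈ nhds (0 : ι → ℝ), ∀ x ∈ U, |e' x| < 1 := by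
    refine ⟨{x | |e' x| < 1}, ?_, fun x hx => hx⟩
    have : ContinuousAt (fun x => |e' x|) 0 := by fun_prop
    exact this.eventually_lt continuousAt_const (by simp)
  rw [nhds_pi, Filter.mem_pi] at hU
  obtain ⟨J, hJ, t, ht, hJU⟩ := hU
  -- A subspace on which `e'` is bounded lies in its kernel.
  have hzero : ∀ x : ι → ℝ, (∀ i ∈ J, x i = 0) → e' x = 0 := by
    intro x hx
    by_contra hne
    have hmem : (e' x)⁻¹ • x ∈ U := hJU fun i hi => by
      simpa [hx i hi] using mem_of_mem_nhds (ht i)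
    simpa [hne] using hUe _ hmem
  refine ⟨hJ.toFinset, fun i => e' (Pi.single i 1), fun x => ?_⟩
  have h := hzero (x - ∑ i ∈ hJ.toFinset, x i • Pi.single i 1) fun i hi => by
    simp [Finset.sum_apply, Pi.single_apply, hi]
  rw [map_sub, map_sum, sub_eq_zero] at h
  rw [h]
  exact Finset.sum_congr rfl fun i _ => by rw [map_smul, smul_eq_mul, mul_comm]

theorem integrable_strongDual_apply {ι Ω : Type*} [MeasurableSpace Ω] {μ : Measure Ω}
    (e' : StrongDual ℝ (ι → ℝ)) {F : ι → Ω → ℝ} (hF : ∀ i, Integrable (F i) μ) :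
    Integrable (fun θ => e' fun i => F i θ) μ := by
  obtain ⟨I, c, h⟩ := exists_finset_forall_strongDual_eq_sum e'
  simp only [h]
  exact integrable_finsetSum _ fun i _ => (hF i).const_mul _

theorem strongDual_integral {ι Ω : Type*} [MeasurableSpace Ω] {μ : Measure Ω}
    (e' : StrongDual ℝ (ι → ℝ)) {F : ι → Ω → ℝ} (hF : ∀ i, Integrable (F i) μ) :
    e' (fun i => ∫ θ, F i θ ∂μ) = ∫ θ, e' (fun i => F i θ) ∂μ := by
  obtain ⟨I, c, h⟩ := exists_finset_forall_strongDual_eq_sum e'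
  simp only [h]
  rw [integral_finsetSum _ fun i _ => (hF i).const_mul _]
  exact Finset.sum_congr rfl fun i _ => (integral_const_mul _ _).symm

theorem measurable_strongDual_apply {ι Ω : Type*} [MeasurableSpace Ω]
    (e' : StrongDual ℝ (ι → ℝ)) {F : ι → Ω → ℝ} (hF : ∀ i, Measurable (F i)) :
    Measurable fun θ => e' fun i => F i θ := by
  obtain ⟨I, c, h⟩ := exists_finset_forall_strongDual_eq_sum e'
  simp only [h]
  exact Finset.measurable_fun_sum _ fun i _ => (hF i).const_mul _

theorem exists_bound_strongDual_apply {ι Ω : Type*} {S : Set Ω}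
    (e' : StrongDual ℝ (ι → ℝ)) {F : ι → Ω → ℝ} (hF : ∀ i, ∃ C, ∀ θ ∈ S, |F i θ| ≤ C) :
    ∃ C, ∀ θ ∈ S, |e' fun i => F i θ| ≤ C := by
  obtain ⟨I, c, h⟩ := exists_finset_forall_strongDual_eq_sum e'
  choose C hC using hF
  refine ⟨∑ i ∈ I, |c i| * C i, fun θ hθ => ?_⟩
  rw [h]
  refine (Finset.abs_sum_le_sum_abs _ _).trans (Finset.sum_le_sum fun i _ => ?_)
  rw [abs_mul]
  exact mul_le_mul_of_nonneg_left (hC i θ hθ) (abs_nonneg _)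

/-! ### The dual basis of the polynomials -/

section DualBasis

variable {a : ℝ} {m : ℕ} {lam : Fin m → StrongDual ℝ (FunSpace a)}
  {P : Fin m → Polynomial.degreeLT ℝ m}

/-- The `m` functionals `lam k` are a basis of the dual of the `m`-dimensional space of
polynomials, so they separate polynomials and interpolation by them is uniquely solvable. -/
theorem bijective_pi_of_linearIndependent
    (hlam : LinearIndependent ℝ (fun k => (lam k).toLinearMap ∘ₗ polyFun a m)) :
    Function.Bijective (LinearMap.pi fun k => (lam k).toLinearMap ∘ₗ polyFun a m) := by
  have : Module.Finite ℝ (Polynomial.degreeLT ℝ m) :=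
    Module.Finite.equiv (Polynomial.degreeLTEquiv ℝ m).symm
  have hfin : Module.finrank ℝ (Polynomial.degreeLT ℝ m) = m := by
    rw [(Polynomial.degreeLTEquiv ℝ m).finrank_eq, Module.finrank_fin_fun]
  have hspan := hlam.span_eq_top_of_card_eq_finrank' (by
    rw [Fintype.card_fin]
    exact hfin.symm.trans (Subspace.dual_finrank_eq (K := ℝ)).symm)
  have hinj : Function.Injective
      (LinearMap.pi fun k => (lam k).toLinearMap ∘ₗ polyFun a m) := by
    rw [← LinearMap.ker_eq_bot, LinearMap.ker_eq_bot']
    intro Q hQ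
    rw [← Module.forall_dual_apply_eq_zero_iff ℝ]
    intro φ
    have hφ : φ ∈ Submodule.span ℝ
        (Set.range fun k => (lam k).toLinearMap ∘ₗ polyFun a m) := hspan ▸ Submodule.mem_top
    induction hφ using Submodule.span_induction with
    | mem ψ hψ => obtain ⟨k, rfl⟩ := hψ; exact congrFun hQ k
    | zero => rfl
    | add ψ χ _ _ h1 h2 => rw [LinearMap.add_apply, h1, h2, add_zero]
    | smul c ψ _ h => rw [LinearMap.smul_apply, h, smul_zero]
  exact ⟨hinj, (LinearMap.injective_iff_surjective_of_finrank_eq_finrank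
    (by rw [hfin, Module.finrank_fin_fun])).1 hinj⟩

theorem existsUnique_isDualBasis
    (hlam : LinearIndependent ℝ (fun k => (lam k).toLinearMap ∘ₗ polyFun a m)) :
    ∃! P : Fin m → Polynomial.degreeLT ℝ m, IsDualBasis lam P := by
  obtain ⟨hinj, hsurj⟩ := bijective_pi_of_linearIndependent hlam
  choose P hP using fun l : Fin m => hsurj fun k => if k = l then 1 else 0
  refine ⟨P, fun k l => congrFun (hP l) k, fun Q hQ => funext fun l => hinj ?_⟩
  rw [hP l]
  exact funext fun k => hQ k l

theorem IsDualBasis.apply_sum_smul (hP : IsDualBasis lam P) (c : Fin m → ℝ) (k : Fin m) :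
    lam k (∑ l, c l • polyFun a m (P l)) = c k := by
  simp [map_sum, map_smul, hP k]

theorem IsDualBasis.polyFun_eq_sum (hP : IsDualBasis lam P)
    (hlam : LinearIndependent ℝ (fun k => (lam k).toLinearMap ∘ₗ polyFun a m))
    (Q : Polynomial.degreeLT ℝ m) :
    polyFun a m Q = ∑ k, lam k (polyFun a m Q) • polyFun a m (P k) := by
  have h : Q = ∑ k, lam k (polyFun a m Q) • P k := by
    refine (bijective_pi_of_linearIndependent hlam).1 (funext fun k => ?_)
    have := hP.apply_sum_smul (fun k => lam k (polyFun a m Q)) k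
    simp only [LinearMap.pi_apply, LinearMap.comp_apply, map_sum, map_smul] at this ⊢
    simpa using this.symm
  conv_lhs => rw [h]
  simp only [map_sum, map_smul]

end DualBasis

/-! ### The Peano kernel and the Peano representation -/

theorem measurable_truncPow (n : ℕ) : Measurable (truncPow n) :=
  Measurable.ite measurableSet_Ioi (by fun_prop) measurable_const

theorem abs_truncPow_le {n : ℕ} {u b : ℝ} (hb : u ≤ b) (hb0 : 0 ≤ b) : |truncPow n u| ≤ b ^ n := by
  unfold truncPow
  split_ifs with h
  · rw [abs_of_nonneg (pow_nonneg h.le n)]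
    exact pow_le_pow_left₀ h.le hb n
  · simpa using pow_nonneg hb0 n

theorem iterPrimitive_indicator_eq_integral_truncPow {a : ℝ} (n : ℕ) {g : ℝ → ℝ}
    (hg : IntegrableOn g (Set.Ioo (-a) a)) (s : Set.Ioo (-a) a) :
    iterPrimitive (-a) ((Set.Ioo (-a) a).indicator g) (n + 1) s =
      ∫ θ in Set.Ioo (-a) a, truncPow n ((s : ℝ) - θ) / n.factorial * g θ := by
  have hg' : Integrable ((Set.Ioo (-a) a).indicator g) := hg.integrable_indicator measurableSet_Ioo
  rw [iterPrimitive_succ_eq_integral _ _ _ fun c d => hg'.intervalIntegrable,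
    intervalIntegral.integral_of_le s.2.1.le, integral_Ioc_eq_integral_Ioo,
    ← integral_indicator measurableSet_Ioo, ← integral_indicator measurableSet_Ioo]
  congr 1
  funext θ
  by_cases h : θ ∈ Set.Ioo (-a) (s : ℝ)
  · have h' : θ ∈ Set.Ioo (-a) a := ⟨h.1, h.2.trans s.2.2⟩
    simp [h, h', truncPow, h.2]
  · by_cases h' : θ ∈ Set.Ioo (-a) a
    · have : ¬ (0 < (s : ℝ) - θ) := fun h0 => h ⟨h'.1, sub_pos.1 h0⟩
      rw [Set.indicator_of_notMem h, Set.indicator_of_mem h', truncPow, if_neg this]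
      simp
    · simp [h, h']

section Peano

variable {a : ℝ} {m : ℕ} (lam : Fin m → StrongDual ℝ (FunSpace a))
  (P : Fin m → Polynomial.degreeLT ℝ m)

theorem exists_bound_truncPow_sub (n : ℕ) (s : Set.Ioo (-a) a) :
    ∃ C, ∀ θ ∈ Set.Ioo (-a) a, |truncPow n ((s : ℝ) - θ)| ≤ C :=
  ⟨(2 * a) ^ n, fun θ hθ => abs_truncPow_le (by linarith [s.2.2, hθ.1])
    (by linarith [hθ.1, hθ.2])⟩

theorem measurable_peanoKernel (s : Set.Ioo (-a) a) : Measurable (peanoKernel lam P s) := by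
  have h (u : Set.Ioo (-a) a) : Measurable fun θ => truncPow (m - 1) ((u : ℝ) - θ) :=
    (measurable_truncPow _).comp (by fun_prop)
  unfold peanoKernel
  exact ((h s).sub (Finset.measurable_fun_sum _ fun k _ =>
    (measurable_strongDual_apply (lam k) h).mul_const _)).div_const _

theorem exists_bound_peanoKernel (s : Set.Ioo (-a) a) :
    ∃ C, ∀ θ ∈ Set.Ioo (-a) a, |peanoKernel lam P s θ| ≤ C := by
  obtain ⟨C, hC⟩ := exists_bound_truncPow_sub (m - 1) s
  choose D hD using fun k => exists_bound_strongDual_apply (lam k)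
    (exists_bound_truncPow_sub (a := a) (m - 1))
  refine ⟨(C + ∑ k, D k * |polyFun a m (P k) s|) / ((m - 1).factorial : ℝ), fun θ hθ => ?_⟩
  rw [peanoKernel, abs_div, Nat.abs_cast]
  gcongr
  refine (abs_sub _ _).trans (add_le_add (hC θ hθ) ?_)
  refine (Finset.abs_sum_le_sum_abs _ _).trans (Finset.sum_le_sum fun k _ => ?_)
  rw [abs_mul]
  exact mul_le_mul_of_nonneg_right (hD k θ hθ) (abs_nonneg _)

theorem measurable_strongDual_peanoKernel (e' : StrongDual ℝ (FunSpace a)) :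
    Measurable fun θ => e' fun s => peanoKernel lam P s θ :=
  measurable_strongDual_apply e' (measurable_peanoKernel lam P)

theorem exists_bound_strongDual_peanoKernel (e' : StrongDual ℝ (FunSpace a)) :
    ∃ C, ∀ θ ∈ Set.Ioo (-a) a, |e' fun s => peanoKernel lam P s θ| ≤ C :=
  exists_bound_strongDual_apply e' (exists_bound_peanoKernel lam P)

theorem integrableOn_mul_of_bound {h g : ℝ → ℝ} {S : Set ℝ} (hS : MeasurableSet S)
    (hm : Measurable h) (hb : ∃ C, ∀ θ ∈ S, |h θ| ≤ C) (hg : IntegrableOn g S) :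
    IntegrableOn (fun θ => h θ * g θ) S := by
  obtain ⟨C, hC⟩ := hb
  refine hg.bdd_mul hm.aestronglyMeasurable (c := C) ?_
  filter_upwards [ae_restrict_mem hS] with θ hθ using hC θ hθ

/-- The integral operator with the Peano kernel. -/
noncomputable def peanoOperator (g : ℝ → ℝ) : FunSpace a :=
  fun s => ∫ θ in Set.Ioo (-a) a, peanoKernel lam P s θ * g θ

variable {lam P} {g : ℝ → ℝ}

theorem integrableOn_peanoKernel_mul (hg : IntegrableOn g (Set.Ioo (-a) a))
    (s : Set.Ioo (-a) a) :
    IntegrableOn (fun θ => peanoKernel lam P s θ * g θ) (Set.Ioo (-a) a) :=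
  integrableOn_mul_of_bound measurableSet_Ioo (measurable_peanoKernel lam P s)
    (exists_bound_peanoKernel lam P s) hg

theorem integrableOn_strongDual_peanoKernel_mul (e' : StrongDual ℝ (FunSpace a))
    (hg : IntegrableOn g (Set.Ioo (-a) a)) :
    IntegrableOn (fun θ => e' (fun s => peanoKernel lam P s θ) * g θ) (Set.Ioo (-a) a) :=
  integrableOn_mul_of_bound measurableSet_Ioo (measurable_strongDual_peanoKernel lam P e')
    (exists_bound_strongDual_peanoKernel lam P e') hg

theorem strongDual_peanoOperator (e' : StrongDual ℝ (FunSpace a))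
    (hg : IntegrableOn g (Set.Ioo (-a) a)) :
    e' (peanoOperator lam P g) =
      ∫ θ in Set.Ioo (-a) a, e' (fun s => peanoKernel lam P s θ) * g θ := by
  unfold peanoOperator
  rw [strongDual_integral e' fun s => integrableOn_peanoKernel_mul hg s]
  congr 1
  funext θ
  have : (fun s => peanoKernel lam P s θ * g θ) = g θ • fun s => peanoKernel lam P s θ :=
    funext fun s => mul_comm _ _
  rw [this, map_smul, smul_eq_mul, mul_comm]

/-- The Peano operator is `y - ∑ k, lam k y • P k`, where `y` is the primitive of order `m`. -/
theorem peanoOperator_eq (hm : 1 ≤ m) (hg : IntegrableOn g (Set.Ioo (-a) a)) {y : FunSpace a}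
    (hy : y = fun s : Set.Ioo (-a) a =>
      iterPrimitive (-a) ((Set.Ioo (-a) a).indicator g) m s) :
    peanoOperator lam P g = y - ∑ k, lam k y • polyFun a m (P k) := by
  obtain ⟨n, rfl⟩ := Nat.exists_eq_add_of_le' hm
  have hT (s : Set.Ioo (-a) a) : IntegrableOn
      (fun θ => truncPow n ((s : ℝ) - θ) / n.factorial * g θ) (Set.Ioo (-a) a) := by
    refine integrableOn_mul_of_bound measurableSet_Ioo
      (((measurable_truncPow n).comp (by fun_prop)).div_const _) ?_ hg
    obtain ⟨C, hC⟩ := exists_bound_truncPow_sub n s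
    refine ⟨C / n.factorial, fun θ hθ => ?_⟩
    rw [abs_div, Nat.abs_cast]
    exact div_le_div_of_nonneg_right (hC θ hθ) (Nat.cast_nonneg _)
  have hy' : y = fun s : Set.Ioo (-a) a =>
      ∫ θ in Set.Ioo (-a) a, truncPow n ((s : ℝ) - θ) / n.factorial * g θ :=
    hy.trans (funext fun s => iterPrimitive_indicator_eq_integral_truncPow n hg s)
  have hlam (k : Fin (n + 1)) : lam k y = ∫ θ in Set.Ioo (-a) a,
      lam k fun s => truncPow n ((s : ℝ) - θ) / n.factorial * g θ := by
    rw [hy', strongDual_integral (lam k) hT]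
  have hlam' (k : Fin (n + 1)) (θ : ℝ) : (lam k fun s => truncPow n ((s : ℝ) - θ) /
      n.factorial * g θ) = lam k (fun s => truncPow n ((s : ℝ) - θ)) / n.factorial * g θ := by
    have : (fun s : Set.Ioo (-a) a => truncPow n ((s : ℝ) - θ) / n.factorial * g θ) =
        (g θ / n.factorial) • fun s : Set.Ioo (-a) a => truncPow n ((s : ℝ) - θ) := by
      funext s
      simp only [Pi.smul_apply, smul_eq_mul]
      ring
    rw [this, map_smul, smul_eq_mul]
    ring
  have hLi (k : Fin (n + 1)) := integrable_strongDual_apply (lam k) hT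
  funext s
  simp only [peanoOperator, Pi.sub_apply, Finset.sum_apply, Pi.smul_apply, smul_eq_mul, hlam]
  rw [congrFun hy' s]
  simp only [← integral_mul_const]
  rw [← integral_finsetSum _ fun k _ => (hLi k).mul_const _, ← integral_sub (hT s)
    (integrable_finsetSum _ fun k _ => (hLi k).mul_const _)]
  congr 1
  funext θ
  simp only [peanoKernel, hlam', Nat.add_sub_cancel, sub_div, sub_mul, Finset.sum_div,
    Finset.sum_mul]
  congr 1
  exact Finset.sum_congr rfl fun k _ => by ring

theorem IsDualBasis.apply_peanoOperator (hP : IsDualBasis lam P) (hm : 1 ≤ m)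
    (hg : IntegrableOn g (Set.Ioo (-a) a)) (k : Fin m) : lam k (peanoOperator lam P g) = 0 := by
  rw [peanoOperator_eq hm hg rfl, map_sub, hP.apply_sum_smul, sub_self]

/-- The functions `∑ k, c k • P k + peanoOperator lam P g` are primitives of order `n + 1` of `g`,
up to a polynomial of degree at most `n`. -/
theorem exists_sum_add_peanoOperator_eq {n : ℕ} {lam : Fin (n + 1) → StrongDual ℝ (FunSpace a)}
    {P : Fin (n + 1) → Polynomial.degreeLT ℝ (n + 1)}
    (c : Fin (n + 1) → ℝ) (hg : IntegrableOn g (Set.Ioo (-a) a)) :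
    ∃ Q ∈ Polynomial.degreeLT ℝ (n + 1), ∀ s : Set.Ioo (-a) a,
      (∑ k, c k • polyFun a (n + 1) (P k) + peanoOperator lam P g) s =
        iterPrimitive (-a) ((Set.Ioo (-a) a).indicator g) (n + 1) s + Q.eval (s : ℝ) := by
  set y : FunSpace a := fun s => iterPrimitive (-a) ((Set.Ioo (-a) a).indicator g) (n + 1) s
    with hy
  set Q : Polynomial.degreeLT ℝ (n + 1) := ∑ k, (c k - lam k y) • P k with hQ
  refine ⟨Q, Q.2, fun s => ?_⟩
  have hQs : polyFun a (n + 1) Q = ∑ k, c k • polyFun a (n + 1) (P k) -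
      ∑ k, lam k y • polyFun a (n + 1) (P k) := by
    rw [hQ]
    simp only [map_sum, map_smul, sub_smul, Finset.sum_sub_distrib]
  change _ = y s + polyFun a (n + 1) Q s
  rw [peanoOperator_eq (Nat.succ_pos n) hg hy, hQs]
  simp only [Pi.add_apply, Pi.sub_apply]
  ring

theorem hasDerivatives_sum_add_peanoOperator (hm : 1 ≤ m) (c : Fin m → ℝ)
    (hg : IntegrableOn g (Set.Ioo (-a) a)) :
    HasDerivatives m (∑ k, c k • polyFun a m (P k) + peanoOperator lam P g) := by
  obtain ⟨n, rfl⟩ := Nat.exists_eq_add_of_le' hm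
  obtain ⟨Q, -, h⟩ := exists_sum_add_peanoOperator_eq (lam := lam) (P := P) c hg
  exact hasDerivatives_of_eq_iterPrimitive_add (hg.integrable_indicator measurableSet_Ioo) h

theorem der_sum_add_peanoOperator_ae_eq (hm : 1 ≤ m) (c : Fin m → ℝ)
    (hg : IntegrableOn g (Set.Ioo (-a) a)) :
    der m (∑ k, c k • polyFun a m (P k) + peanoOperator lam P g)
      =ᵐ[volume.restrict (Set.Ioo (-a) a)] g := by
  obtain ⟨n, rfl⟩ := Nat.exists_eq_add_of_le' hm
  obtain ⟨Q, hQ, h⟩ := exists_sum_add_peanoOperator_eq (lam := lam) (P := P) c hg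
  refine (der_ae_eq_of_eq_iterPrimitive_add (hg.integrable_indicator measurableSet_Ioo)
    hQ h).trans ?_
  filter_upwards [ae_restrict_mem measurableSet_Ioo] with t ht using Set.indicator_of_mem ht g

theorem memLp_der_sum_add_peanoOperator (hm : 1 ≤ m) (c : Fin m → ℝ)
    (hg : IntegrableOn g (Set.Ioo (-a) a)) {r : ENNReal}
    (hgr : MemLp g r (volume.restrict (Set.Ioo (-a) a))) {j : ℕ} (hj : j ≤ m) :
    MemLp (der j (∑ k, c k • polyFun a m (P k) + peanoOperator lam P g)) r
      (volume.restrict (Set.Ioo (-a) a)) := by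
  obtain rfl | hj := hj.eq_or_lt
  · exact hgr.ae_eq (der_sum_add_peanoOperator_ae_eq hm c hg).symm
  · obtain ⟨n, rfl⟩ := Nat.exists_eq_add_of_le' hm
    obtain ⟨Q, -, h⟩ := exists_sum_add_peanoOperator_eq (lam := lam) (P := P) c hg
    exact memLp_der_of_eq_iterPrimitive_add (hg.integrable_indicator measurableSet_Ioo) h
      (Nat.lt_succ_iff.1 hj) r

/-- The Peano representation: `x` and the Peano operator applied to `x^(m)` differ by a polynomial,
which the values of the functionals `lam k` determine. -/
theorem IsDualBasis.eq_sum_add_peanoOperator (hP : IsDualBasis lam P) (hm : 1 ≤ m) (ha : 0 < a)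
    (hlam : LinearIndependent ℝ (fun k => (lam k).toLinearMap ∘ₗ polyFun a m))
    {x : FunSpace a} (hx : HasDerivatives m x)
    (hi : IntegrableOn (der m x) (Set.Ioo (-a) a)) :
    x = ∑ k, lam k x • polyFun a m (P k) + peanoOperator lam P (der m x) := by
  obtain ⟨Q, hQ⟩ : ∃ Q : Polynomial.degreeLT ℝ m,
      x = (fun s : Set.Ioo (-a) a =>
        iterPrimitive (-a) ((Set.Ioo (-a) a).indicator (der m x)) m s) + polyFun a m Q := by
    obtain ⟨n, rfl⟩ := Nat.exists_eq_add_of_le' hm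
    obtain ⟨Q, hQ, h⟩ := hx.exists_eq_iterPrimitive_add ha hi
    exact ⟨⟨Q, hQ⟩, funext h⟩
  set y : FunSpace a := fun s : Set.Ioo (-a) a =>
    iterPrimitive (-a) ((Set.Ioo (-a) a).indicator (der m x)) m s with hy
  rw [peanoOperator_eq hm hi hy]
  have hl (k : Fin m) : lam k x = lam k y + lam k (polyFun a m Q) := by rw [← map_add, ← hQ]
  simp only [hl, add_smul, Finset.sum_add_distrib, ← hP.polyFun_eq_sum hlam Q]
  conv_lhs => rw [hQ]
  abel

end Peano

/-! ### Young's inequality and its case of equality -/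

section Young

variable {p q : ℝ}

theorem abs_alpha (hpq : p.HolderConjugate q) (b : ℝ) : |alpha q b| = |b| ^ (q - 1) := by
  obtain h | rfl | h := lt_trichotomy b 0
  · rw [alpha, Real.sign_of_neg h, mul_neg_one, abs_neg, abs_of_nonneg (by positivity)]
  · simp [alpha, Real.zero_rpow (sub_ne_zero.2 hpq.symm.lt.ne')]
  · rw [alpha, Real.sign_of_pos h, mul_one, abs_of_nonneg (by positivity)]

theorem mul_alpha (hpq : p.HolderConjugate q) (b : ℝ) : b * alpha q b = |b| ^ q := by
  have hs : b * b.sign = |b| := by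
    obtain h | rfl | h := lt_trichotomy b 0
    · rw [Real.sign_of_neg h, mul_neg_one, abs_of_neg h]
    · simp
    · rw [Real.sign_of_pos h, mul_one, abs_of_pos h]
  obtain rfl | h := eq_or_ne b 0
  · simp [Real.zero_rpow hpq.symm.pos.ne']
  · rw [alpha, mul_left_comm, hs, ← Real.rpow_add_one (abs_ne_zero.2 h), sub_add_cancel]

theorem abs_alpha_rpow (hpq : p.HolderConjugate q) (b : ℝ) : |alpha q b| ^ p = |b| ^ q := by
  rw [abs_alpha hpq, ← Real.rpow_mul (abs_nonneg b), hpq.symm.sub_one_mul_conj]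

theorem continuous_alpha (hpq : p.HolderConjugate q) : Continuous (alpha q) := by
  have hq : 0 ≤ q - 1 := hpq.symm.sub_one_pos.le
  have hq0 : q - 1 ≠ 0 := hpq.symm.sub_one_pos.ne'
  -- The formula through positive and negative parts avoids the jump of the sign at `0`.
  have h : alpha q = fun b => (max b 0) ^ (q - 1) - (max (-b) 0) ^ (q - 1) := by
    funext b
    obtain h | rfl | h := lt_trichotomy b 0
    · rw [alpha, Real.sign_of_neg h, max_eq_right h.le, max_eq_left (neg_pos.2 h).le,
        Real.zero_rpow hq0, abs_of_neg h, mul_neg_one, zero_sub]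
    · simp [alpha]
    · rw [alpha, Real.sign_of_pos h, max_eq_left h.le, max_eq_right (neg_neg_of_pos h).le,
        Real.zero_rpow hq0, abs_of_pos h, mul_one, sub_zero]
  rw [h]
  exact ((continuous_id.max continuous_const).rpow_const fun _ => Or.inr hq).sub
    ((continuous_neg.max continuous_const).rpow_const fun _ => Or.inr hq)

/-- The concave function `c ↦ b c - |c|^p / p` attains its maximum at `α_q(b)`. -/
theorem mul_sub_abs_rpow_div_le (hpq : p.HolderConjugate q) (b c : ℝ) :
    b * c - |c| ^ p / p ≤ b * alpha q b - |alpha q b| ^ p / p := by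
  have h := Real.young_inequality c b hpq
  have h1 : |b| ^ q = |b| ^ q / p + |b| ^ q / q := by
    rw [div_eq_mul_inv, div_eq_mul_inv, ← mul_add, hpq.inv_add_inv_eq_one, mul_one]
  rw [mul_alpha hpq, abs_alpha_rpow hpq]
  linarith [mul_comm b c]

theorem sum_mul_sub_le (hpq : p.HolderConjugate q) {ι : Type*} [Fintype ι] (b c : ι → ℝ) :
    ∑ k, b k * c k - (∑ k, |c k| ^ p) / p ≤
      ∑ k, b k * alpha q (b k) - (∑ k, |alpha q (b k)| ^ p) / p := by
  simp only [Finset.sum_div, ← Finset.sum_sub_distrib]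
  exact Finset.sum_le_sum fun k _ => mul_sub_abs_rpow_div_le hpq _ _

theorem memLp_alpha (hpq : p.HolderConjugate q) {h : ℝ → ℝ} {S : Set ℝ} (hS : MeasurableSet S)
    (hSv : volume S < ⊤) (hm : Measurable h) (hb : ∃ C, ∀ θ ∈ S, |h θ| ≤ C) (r : ENNReal) :
    MemLp (fun θ => alpha q (h θ)) r (volume.restrict S) := by
  obtain ⟨C, hC⟩ := hb
  have : IsFiniteMeasure (volume.restrict S) := ⟨by simpa using hSv⟩
  refine MemLp.of_bound ((continuous_alpha hpq).measurable.comp hm).aestronglyMeasurable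
    (C ^ (q - 1)) ?_
  filter_upwards [ae_restrict_mem hS] with θ hθ
  rw [Real.norm_eq_abs, abs_alpha hpq]
  exact Real.rpow_le_rpow (abs_nonneg _) (hC θ hθ) hpq.symm.sub_one_pos.le

theorem integrable_abs_rpow_of_memLp (hp : 0 < p) {μ : Measure ℝ} {g : ℝ → ℝ}
    (hg : MemLp g (ENNReal.ofReal p) μ) : Integrable (fun θ => |g θ| ^ p) μ := by
  have h := hg.integrable_norm_rpow (by simpa using hp) ENNReal.ofReal_ne_top
  simpa only [Real.norm_eq_abs, ENNReal.toReal_ofReal hp.le] using h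

theorem integral_mul_sub_le (hpq : p.HolderConjugate q) {h g : ℝ → ℝ} {S : Set ℝ}
    (hS : MeasurableSet S) (hSv : volume S < ⊤) (hm : Measurable h)
    (hb : ∃ C, ∀ θ ∈ S, |h θ| ≤ C) (hg : MemLp g (ENNReal.ofReal p) (volume.restrict S)) :
    (∫ θ in S, h θ * g θ) - (∫ θ in S, |g θ| ^ p) / p ≤
      (∫ θ in S, h θ * alpha q (h θ)) - (∫ θ in S, |alpha q (h θ)| ^ p) / p := by
  have : IsFiniteMeasure (volume.restrict S) := ⟨by simpa using hSv⟩
  have hα := memLp_alpha hpq hS hSv hm hb (ENNReal.ofReal p)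
  have hp1 : (1 : ENNReal) ≤ ENNReal.ofReal p := by simpa using hpq.lt.le
  have h1 := integrableOn_mul_of_bound hS hm hb (hg.integrable hp1)
  have h2 := integrableOn_mul_of_bound hS hm hb (hα.integrable hp1)
  have h3 := (integrable_abs_rpow_of_memLp hpq.pos hg).div_const p
  have h4 := (integrable_abs_rpow_of_memLp hpq.pos hα).div_const p
  rw [← integral_div, ← integral_div, ← integral_sub h1 h3, ← integral_sub h2 h4]
  exact integral_mono (h1.sub h3) (h2.sub h4) fun θ => mul_sub_abs_rpow_div_le hpq _ _

end Young

/-! ### Single-valued banachic kernels -/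

theorem coe_sub_powerPotential_of_mem {E : Type*} {B : Set E} {N : E → ℝ} {p : ℝ} {e : E}
    (he : e ∈ B) (r : ℝ) :
    (r : EReal) - powerPotential B N p e = ((r - N e ^ p / p : ℝ) : EReal) := by
  rw [powerPotential, if_pos he, EReal.coe_sub]

/-- Suppose that `A e'` maximizes `e' e - N e ^ p / p` over `B` for every `e'`, and that `A` is
continuous along lines. Then the subdifferential of the conjugate function contains `A e'`, and any
other element `y` satisfies `d' y ≤ d' (A (e' + t • d'))` for all `t > 0` and all `d'`,
hence is equal to `A e'`. -/
theorem banachicKernel_powerPotential_eq_singleton {ι : Type*} {B : Set (ι → ℝ)}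
    {N : (ι → ℝ) → ℝ} {p : ℝ} {A : StrongDual ℝ (ι → ℝ) → ι → ℝ} (hA : ∀ e', A e' ∈ B)
    (hmax : ∀ e', ∀ e ∈ B, e' e - N e ^ p / p ≤ e' (A e') - N (A e') ^ p / p)
    (hcont : ∀ e' d' : StrongDual ℝ (ι → ℝ),
      Filter.Tendsto (fun t : ℝ => d' (A (e' + t • d'))) (nhdsWithin 0 (Set.Ioi 0))
        (nhds (d' (A e'))))
    (e' : StrongDual ℝ (ι → ℝ)) : banachicKernel (powerPotential B N p) e' = {A e'} := by
  have hF (e' : StrongDual ℝ (ι → ℝ)) : legendreFenchel (powerPotential B N p) e' =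
      ((e' (A e') - N (A e') ^ p / p : ℝ) : EReal) := by
    refine le_antisymm (iSup_le fun e => ?_) ?_
    · by_cases he : e ∈ B
      · rw [coe_sub_powerPotential_of_mem he]
        exact_mod_cast hmax e' e he
      · simp [powerPotential, he]
    · rw [← coe_sub_powerPotential_of_mem (hA e')]
      exact le_iSup (fun e => ((e' e : ℝ) : EReal) - powerPotential B N p e) (A e')
  have hmem (y : ι → ℝ) : y ∈ banachicKernel (powerPotential B N p) e' ↔
      ∀ f' : StrongDual ℝ (ι → ℝ), e' (A e') - N (A e') ^ p / p + (f' y - e' y) ≤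
        f' (A f') - N (A f') ^ p / p := by
    refine forall_congr' fun f' => ?_
    rw [hF, hF, ← EReal.coe_add, EReal.coe_le_coe_iff]
  ext y
  rw [Set.mem_singleton_iff, hmem]
  refine ⟨fun h => ?_, ?_⟩
  · have hle (d' : StrongDual ℝ (ι → ℝ)) : d' y ≤ d' (A e') := by
      -- Compare the subgradient inequality for `y` in the direction `t • d'` with the
      -- maximality of `A e'` for `e'`, tested on `A (e' + t • d')`.
      refine ge_of_tendsto (hcont e' d') ?_
      filter_upwards [self_mem_nhdsWithin] with t ht
      have h1 := h (e' + t • d')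
      have h2 := hmax e' _ (hA (e' + t • d'))
      simp only [add_apply, smul_apply, smul_eq_mul] at h1
      exact le_of_mul_le_mul_left (by linarith) (Set.mem_Ioi.1 ht)
    funext i
    refine le_antisymm (hle (ContinuousLinearMap.proj i)) ?_
    simpa using hle (-ContinuousLinearMap.proj i)
  · rintro rfl f'
    linarith [hmax f' _ (hA e')]

/-! ### The maximizers -/

section Kernels

variable {a : ℝ} {m : ℕ} (lam : Fin m → StrongDual ℝ (FunSpace a))
  (P : Fin m → Polynomial.degreeLT ℝ m) (q : ℝ)

/-- The banachic kernel of the space of polynomials. -/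
noncomputable def polyKernel (e' : StrongDual ℝ (FunSpace a)) : FunSpace a :=
  ∑ k, alpha q (e' (polyFun a m (P k))) • polyFun a m (P k)

/-- The banachic kernel of the space of functions annihilated by the functionals `lam k`. -/
noncomputable def integralKernel (e' : StrongDual ℝ (FunSpace a)) : FunSpace a :=
  peanoOperator lam P fun θ => alpha q (e' fun s => peanoKernel lam P s θ)

variable {lam P q} {p : ℝ}

theorem strongDual_polyKernel (e' f' : StrongDual ℝ (FunSpace a)) :
    f' (polyKernel P q e') =
      ∑ k, alpha q (e' (polyFun a m (P k))) * f' (polyFun a m (P k)) := by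
  simp [polyKernel, map_sum, map_smul]

theorem memLp_alpha_strongDual_peanoKernel (hpq : p.HolderConjugate q)
    (e' : StrongDual ℝ (FunSpace a)) (r : ENNReal) :
    MemLp (fun θ => alpha q (e' fun s => peanoKernel lam P s θ)) r
      (volume.restrict (Set.Ioo (-a) a)) :=
  memLp_alpha hpq measurableSet_Ioo measure_Ioo_lt_top
    (measurable_strongDual_peanoKernel lam P e') (exists_bound_strongDual_peanoKernel lam P e') r

theorem integrableOn_alpha_strongDual_peanoKernel (hpq : p.HolderConjugate q)
    (e' : StrongDual ℝ (FunSpace a)) :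
    IntegrableOn (fun θ => alpha q (e' fun s => peanoKernel lam P s θ)) (Set.Ioo (-a) a) :=
  memLp_one_iff_integrable.1 (memLp_alpha_strongDual_peanoKernel hpq e' 1)

theorem strongDual_integralKernel (hpq : p.HolderConjugate q)
    (e' f' : StrongDual ℝ (FunSpace a)) :
    f' (integralKernel lam P q e') = ∫ θ in Set.Ioo (-a) a,
      f' (fun s => peanoKernel lam P s θ) * alpha q (e' fun s => peanoKernel lam P s θ) :=
  strongDual_peanoOperator f' (integrableOn_alpha_strongDual_peanoKernel hpq e')

theorem tendsto_strongDual_polyKernel (hpq : p.HolderConjugate q)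
    (e' d' : StrongDual ℝ (FunSpace a)) :
    Filter.Tendsto (fun t : ℝ => d' (polyKernel P q (e' + t • d')))
      (nhdsWithin 0 (Set.Ioi 0)) (nhds (d' (polyKernel P q e'))) := by
  have hα := continuous_alpha hpq
  have hc : Continuous fun t : ℝ => d' (polyKernel P q (e' + t • d')) := by
    simp only [strongDual_polyKernel, add_apply, smul_apply, smul_eq_mul]
    fun_prop
  have h := hc.tendsto 0
  rw [zero_smul, add_zero] at h
  exact h.mono_left nhdsWithin_le_nhds

theorem tendsto_strongDual_integralKernel (hpq : p.HolderConjugate q)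
    (e' d' : StrongDual ℝ (FunSpace a)) :
    Filter.Tendsto (fun t : ℝ => d' (integralKernel lam P q (e' + t • d')))
      (nhdsWithin 0 (Set.Ioi 0)) (nhds (d' (integralKernel lam P q e'))) := by
  have hα := continuous_alpha hpq
  have hm (e' : StrongDual ℝ (FunSpace a)) := measurable_strongDual_peanoKernel lam P e'
  obtain ⟨C, hC⟩ := exists_bound_strongDual_peanoKernel lam P e'
  obtain ⟨D, hD⟩ := exists_bound_strongDual_peanoKernel lam P d'
  simp only [strongDual_integralKernel hpq]
  refine tendsto_integral_filter_of_dominated_convergence (fun _ => D * (C + D) ^ (q - 1))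
    (Filter.Eventually.of_forall fun t =>
      ((hm d').mul (hα.measurable.comp (hm _))).aestronglyMeasurable) ?_
    (integrable_const _) (Filter.Eventually.of_forall fun θ => ?_)
  · have h1 : ∀ᶠ t : ℝ in nhdsWithin 0 (Set.Ioi 0), t ≤ 1 :=
      nhdsWithin_le_nhds (Iic_mem_nhds one_pos)
    filter_upwards [h1, self_mem_nhdsWithin] with t ht1 ht0
    filter_upwards [ae_restrict_mem measurableSet_Ioo] with θ hθ
    have hD0 : 0 ≤ D := (abs_nonneg _).trans (hD θ hθ)
    rw [norm_mul, Real.norm_eq_abs, Real.norm_eq_abs, abs_alpha hpq]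
    refine mul_le_mul (hD θ hθ) (Real.rpow_le_rpow (abs_nonneg _) ?_ hpq.symm.sub_one_pos.le)
      (by positivity) hD0
    simp only [add_apply, smul_apply, smul_eq_mul]
    refine (abs_add_le _ _).trans (add_le_add (hC θ hθ) ?_)
    rw [abs_mul, abs_of_pos ht0]
    exact (mul_le_mul ht1 (hD θ hθ) (abs_nonneg _) zero_le_one).trans_eq (one_mul D)
  · have hc : Continuous fun t : ℝ => d' (fun s => peanoKernel lam P s θ) *
        alpha q ((e' + t • d') fun s => peanoKernel lam P s θ) := by
      simp only [add_apply, smul_apply, smul_eq_mul]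
      fun_prop
    have h := hc.tendsto 0
    rw [zero_smul, add_zero] at h
    exact h.mono_left nhdsWithin_le_nhds

theorem rpow_one_div_rpow_div {X : ℝ} (hX : 0 ≤ X) (hp : p ≠ 0) : (X ^ (1 / p)) ^ p / p = X / p := by
  rw [← Real.rpow_mul hX, one_div_mul_cancel hp, Real.rpow_one]

theorem sum_abs_rpow_nonneg (x : FunSpace a) : 0 ≤ ∑ k, |lam k x| ^ p :=
  Finset.sum_nonneg fun _ _ => by positivity

theorem integral_abs_der_rpow_nonneg (x : FunSpace a) :
    0 ≤ ∫ t in Set.Ioo (-a) a, |der m x t| ^ p :=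
  integral_nonneg fun _ => by positivity

theorem normA_rpow_div (hp : p ≠ 0) (x : FunSpace a) : normA lam p x ^ p / p =
    (∑ k, |lam k x| ^ p) / p + (∫ t in Set.Ioo (-a) a, |der m x t| ^ p) / p := by
  rw [normA, rpow_one_div_rpow_div
    (add_nonneg (sum_abs_rpow_nonneg x) (integral_abs_der_rpow_nonneg x)) hp, add_div]

theorem normR_rpow_div (hp : p ≠ 0) (x : FunSpace a) :
    normR lam p x ^ p / p = (∑ k, |lam k x| ^ p) / p :=
  rpow_one_div_rpow_div (sum_abs_rpow_nonneg x) hp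

theorem normC_rpow_div (hp : p ≠ 0) (x : FunSpace a) :
    normC m p x ^ p / p = (∫ t in Set.Ioo (-a) a, |der m x t| ^ p) / p :=
  rpow_one_div_rpow_div (integral_abs_der_rpow_nonneg x) hp

theorem integral_abs_rpow_congr {f g : ℝ → ℝ} {μ : Measure ℝ} (h : f =ᵐ[μ] g) :
    ∫ t, |f t| ^ p ∂μ = ∫ t, |g t| ^ p ∂μ := by
  refine integral_congr_ae ?_
  filter_upwards [h] with t ht using by rw [ht]

/-- The Peano representation, tested with a continuous functional. -/
theorem IsDualBasis.strongDual_eq (hP : IsDualBasis lam P) (hm : 1 ≤ m) (ha : 0 < a)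
    (hlam : LinearIndependent ℝ (fun k => (lam k).toLinearMap ∘ₗ polyFun a m))
    {x : FunSpace a} (hx : HasDerivatives m x) (hi : IntegrableOn (der m x) (Set.Ioo (-a) a))
    (e' : StrongDual ℝ (FunSpace a)) :
    e' x = ∑ k, e' (polyFun a m (P k)) * lam k x +
      ∫ θ in Set.Ioo (-a) a, e' (fun s => peanoKernel lam P s θ) * der m x θ := by
  rw [← strongDual_peanoOperator e' hi]
  conv_lhs => rw [hP.eq_sum_add_peanoOperator hm ha hlam hx hi]
  simp only [map_add, map_sum, map_smul, smul_eq_mul, mul_comm]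

theorem kernelR_eq (hpq : p.HolderConjugate q) (hP : IsDualBasis lam P)
    (hlam : LinearIndependent ℝ (fun k => (lam k).toLinearMap ∘ₗ polyFun a m))
    (e' : StrongDual ℝ (FunSpace a)) : kernelR lam p e' = {polyKernel P q e'} := by
  refine banachicKernel_powerPotential_eq_singleton (fun e' => ?_) (fun e' e he => ?_)
    (tendsto_strongDual_polyKernel hpq) e'
  · exact ⟨∑ k, alpha q (e' (polyFun a m (P k))) • P k, by simp [polyKernel, map_sum, map_smul]⟩
  · obtain ⟨Q, rfl⟩ := he
    have h : e' (polyFun a m Q) =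
        ∑ k, e' (polyFun a m (P k)) * lam k (polyFun a m Q) := by
      conv_lhs => rw [hP.polyFun_eq_sum hlam Q]
      simp only [map_sum, map_smul, smul_eq_mul, mul_comm]
    have hk (k : Fin m) : lam k (polyKernel P q e') = alpha q (e' (polyFun a m (P k))) :=
      hP.apply_sum_smul _ k
    rw [normR_rpow_div hpq.pos.ne', normR_rpow_div hpq.pos.ne', strongDual_polyKernel, h]
    simp only [hk, mul_comm (alpha q _)]
    exact sum_mul_sub_le hpq _ _

theorem integrableOn_of_memLp (hpq : p.HolderConjugate q) {g : ℝ → ℝ}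
    (hg : MemLp g (ENNReal.ofReal p) (volume.restrict (Set.Ioo (-a) a))) :
    IntegrableOn g (Set.Ioo (-a) a) :=
  hg.integrable (by simpa using hpq.lt.le)

/-- Among the functions `g` in `L^p` the concave functional `∫ h g - ‖g‖^p / p`, where
`h(θ) = e' (Λ_m(·, θ))`, is maximal at `g = α_q(h)`, the derivative of order `m`
of `x`. -/
theorem strongDual_peanoKernel_integral_sub_le (hpq : p.HolderConjugate q) {g : ℝ → ℝ}
    (hg : MemLp g (ENNReal.ofReal p) (volume.restrict (Set.Ioo (-a) a)))
    (e' : StrongDual ℝ (FunSpace a)) {x : FunSpace a}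
    (hx : der m x =ᵐ[volume.restrict (Set.Ioo (-a) a)]
      fun θ => alpha q (e' fun s => peanoKernel lam P s θ)) :
    (∫ θ in Set.Ioo (-a) a, e' (fun s => peanoKernel lam P s θ) * g θ) -
        (∫ θ in Set.Ioo (-a) a, |g θ| ^ p) / p ≤
      e' (integralKernel lam P q e') - (∫ θ in Set.Ioo (-a) a, |der m x θ| ^ p) / p := by
  rw [strongDual_integralKernel hpq, integral_abs_rpow_congr hx]
  exact integral_mul_sub_le hpq measurableSet_Ioo measure_Ioo_lt_top
    (measurable_strongDual_peanoKernel lam P e') (exists_bound_strongDual_peanoKernel lam P e') hg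

theorem kernelC_eq (hpq : p.HolderConjugate q) (hP : IsDualBasis lam P) (hm : 1 ≤ m) (ha : 0 < a)
    (hlam : LinearIndependent ℝ (fun k => (lam k).toLinearMap ∘ₗ polyFun a m))
    (e' : StrongDual ℝ (FunSpace a)) : kernelC lam p e' = {integralKernel lam P q e'} := by
  -- Present the kernel in the form `∑ k, c k • P k + peanoOperator lam P g`, with `c = 0`.
  have h0 (e' : StrongDual ℝ (FunSpace a)) :
      ∑ k, (0 : Fin m → ℝ) k • polyFun a m (P k) + integralKernel lam P q e' =
        integralKernel lam P q e' := by simp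
  refine banachicKernel_powerPotential_eq_singleton (B := spaceC lam p) (N := normC m p)
    (A := integralKernel lam P q) (fun e' => ⟨?_, ?_, ?_⟩) (fun e' e he => ?_)
    (tendsto_strongDual_integralKernel hpq) e'
  · rw [← h0]
    exact hasDerivatives_sum_add_peanoOperator hm 0
      (integrableOn_alpha_strongDual_peanoKernel hpq e')
  · rw [← h0]
    exact memLp_der_sum_add_peanoOperator hm 0 (integrableOn_alpha_strongDual_peanoKernel hpq e')
      (memLp_alpha_strongDual_peanoKernel hpq e' _) le_rfl
  · exact hP.apply_peanoOperator hm (integrableOn_alpha_strongDual_peanoKernel hpq e')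
  · obtain ⟨hx, hxp, hx0⟩ := he
    have hder := der_sum_add_peanoOperator_ae_eq (lam := lam) (P := P) hm 0
      (integrableOn_alpha_strongDual_peanoKernel (lam := lam) (P := P) hpq e')
    rw [normC_rpow_div hpq.pos.ne', normC_rpow_div hpq.pos.ne',
      hP.strongDual_eq hm ha hlam hx (integrableOn_of_memLp hpq hxp)]
    simp only [hx0, mul_zero, Finset.sum_const_zero, zero_add]
    refine strongDual_peanoKernel_integral_sub_le hpq hxp e' ?_
    rw [← h0]
    exact hder

theorem kernelA_eq (hpq : p.HolderConjugate q) (hP : IsDualBasis lam P) (hm : 1 ≤ m) (ha : 0 < a)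
    (hlam : LinearIndependent ℝ (fun k => (lam k).toLinearMap ∘ₗ polyFun a m))
    (e' : StrongDual ℝ (FunSpace a)) :
    kernelA lam p e' = {polyKernel P q e' + integralKernel lam P q e'} := by
  refine banachicKernel_powerPotential_eq_singleton (B := spaceA a m p) (N := normA lam p)
    (A := fun e' => polyKernel P q e' + integralKernel lam P q e') (fun e' => ⟨?_, ?_⟩)
    (fun e' e he => ?_) (fun e' d' => ?_) e'
  · exact hasDerivatives_sum_add_peanoOperator hm _
      (integrableOn_alpha_strongDual_peanoKernel hpq e')
  · intro j hj
    exact memLp_der_sum_add_peanoOperator hm _ (integrableOn_alpha_strongDual_peanoKernel hpq e')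
      (memLp_alpha_strongDual_peanoKernel hpq e' _) hj
  · obtain ⟨hx, hxp⟩ := he
    have hxm := hxp m le_rfl
    have hder := der_sum_add_peanoOperator_ae_eq (lam := lam) (P := P) hm
      (fun k => alpha q (e' (polyFun a m (P k))))
      (integrableOn_alpha_strongDual_peanoKernel (lam := lam) (P := P) hpq e')
    have hk (k : Fin m) : lam k (polyKernel P q e' + integralKernel lam P q e') =
        alpha q (e' (polyFun a m (P k))) := by
      rw [map_add, polyKernel, hP.apply_sum_smul, integralKernel, hP.apply_peanoOperator hm
        (integrableOn_alpha_strongDual_peanoKernel hpq e'), add_zero]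
    have h1 := strongDual_peanoKernel_integral_sub_le hpq hxm e' hder
    have h2 := sum_mul_sub_le hpq (fun k => e' (polyFun a m (P k))) fun k => lam k e
    rw [normA_rpow_div hpq.pos.ne', normA_rpow_div hpq.pos.ne', map_add,
      hP.strongDual_eq hm ha hlam hx (integrableOn_of_memLp hpq hxm)]
    simp only [hk, strongDual_polyKernel, mul_comm (alpha q _)]
    -- Unfold the sum of the two kernels under the derivative, as it appears in `h1`.
    change _ ≤ _ + _ - (_ + (∫ t in Set.Ioo (-a) a, |der m
      (∑ k, alpha q (e' (polyFun a m (P k))) • polyFun a m (P k) + peanoOperator lam P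
        fun θ => alpha q (e' fun s => peanoKernel lam P s θ)) t| ^ p) / p)
    linarith
  · simp only [map_add]
    exact (tendsto_strongDual_polyKernel hpq e' d').add
      (tendsto_strongDual_integralKernel hpq e' d')

end Kernels

end BanachicKernel

theorem mainTheorem1 (a : ℝ) (ha : 0 < a) (m : ℕ) (hm : 1 ≤ m)
    (p q : ℝ) (hp : 1 < p) (hpq : 1 / p + 1 / q = 1)
    (lam : Fin m → StrongDual ℝ (BanachicKernel.FunSpace a))
    (hlam : LinearIndependent ℝ
      (fun k => (lam k).toLinearMap ∘ₗ BanachicKernel.polyFun a m)) :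
    (∃! P : Fin m → Polynomial.degreeLT ℝ m, BanachicKernel.IsDualBasis lam P) ∧
    ∀ P : Fin m → Polynomial.degreeLT ℝ m, BanachicKernel.IsDualBasis lam P →
      -- `peanoKernel` is the kernel in the Peano representation of the functions of `𝒜_p`
      (∀ x ∈ BanachicKernel.spaceA a m p, ∀ s : Set.Ioo (-a) a,
        IntegrableOn (fun θ => BanachicKernel.peanoKernel lam P s θ * BanachicKernel.der m x θ)
          (Set.Ioo (-a) a) ∧
        x s = ∑ k, lam k x * BanachicKernel.polyFun a m (P k) s +
          ∫ θ in Set.Ioo (-a) a,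
            BanachicKernel.peanoKernel lam P s θ * BanachicKernel.der m x θ) ∧
      ∃ A R C : StrongDual ℝ (BanachicKernel.FunSpace a) → BanachicKernel.FunSpace a,
        -- the three kernels are single-valued, with values `A e'`, `R e'`, `C e'`
        (∀ e', BanachicKernel.kernelA lam p e' = {A e'}) ∧
        (∀ e', BanachicKernel.kernelR lam p e' = {R e'}) ∧
        (∀ e', BanachicKernel.kernelC lam p e' = {C e'}) ∧
        -- (i)
        (∀ e' f' : StrongDual ℝ (BanachicKernel.FunSpace a),
          f' (R e') = ∑ k, BanachicKernel.alpha q (e' (BanachicKernel.polyFun a m (P k))) *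
            f' (BanachicKernel.polyFun a m (P k))) ∧
        (∀ e' f' : StrongDual ℝ (BanachicKernel.FunSpace a),
          IntegrableOn (fun θ => f' (fun s => BanachicKernel.peanoKernel lam P s θ) *
              BanachicKernel.alpha q (e' (fun s => BanachicKernel.peanoKernel lam P s θ)))
            (Set.Ioo (-a) a) ∧
          f' (C e') = ∫ θ in Set.Ioo (-a) a,
            f' (fun s => BanachicKernel.peanoKernel lam P s θ) *
              BanachicKernel.alpha q (e' (fun s => BanachicKernel.peanoKernel lam P s θ))) ∧
        -- (ii)
        (∀ e', A e' = R e' + C e') ∧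
        -- the pointwise formula
        (∀ s t : Set.Ioo (-a) a,
          BanachicKernel.dirac t (A (BanachicKernel.dirac s)) =
            ∑ k, BanachicKernel.polyFun a m (P k) t *
                BanachicKernel.alpha q (BanachicKernel.polyFun a m (P k) s) +
              ∫ θ in Set.Ioo (-a) a, BanachicKernel.peanoKernel lam P t θ *
                BanachicKernel.alpha q (BanachicKernel.peanoKernel lam P s θ)) := by
  have hpq' : p.HolderConjugate q :=
    Real.holderConjugate_iff.2 ⟨hp, by simpa only [one_div] using hpq⟩
  refine ⟨BanachicKernel.existsUnique_isDualBasis hlam, fun P hP => ⟨fun x hx s => ?_,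
    fun e' => BanachicKernel.polyKernel P q e' + BanachicKernel.integralKernel lam P q e',
    BanachicKernel.polyKernel P q, BanachicKernel.integralKernel lam P q,
    BanachicKernel.kernelA_eq hpq' hP hm ha hlam, BanachicKernel.kernelR_eq hpq' hP hlam,
    BanachicKernel.kernelC_eq hpq' hP hm ha hlam, BanachicKernel.strongDual_polyKernel,
    fun e' f' => ⟨?_, BanachicKernel.strongDual_integralKernel hpq' e' f'⟩, fun _ => rfl,
    fun s t => ?_⟩⟩
  · have hi := BanachicKernel.integrableOn_of_memLp hpq' (hx.2 m le_rfl)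
    refine ⟨BanachicKernel.integrableOn_peanoKernel_mul hi s, ?_⟩
    simpa [BanachicKernel.peanoOperator] using
      congrFun (hP.eq_sum_add_peanoOperator hm ha hlam hx.1 hi) s
  · exact BanachicKernel.integrableOn_strongDual_peanoKernel_mul f'
      (BanachicKernel.integrableOn_alpha_strongDual_peanoKernel hpq' e')
  · rw [map_add, BanachicKernel.strongDual_polyKernel,
      BanachicKernel.strongDual_integralKernel hpq']
    congr 1
    exact Finset.sum_congr rfl fun k _ => mul_comm _ _
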